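/- Let $G$ be a local analytic Moufang loop: on a finite-dimensional real analytic manifold $G$ with a distinguished point $e$ there are given a multiplication $(g,h)\mapsto gh$ and left and right divisions, real analytic near $(e,e)$, such that for all arguments sufficiently close to $e$ one has $eg=ge=g$, the divisions invert left and right multiplication, and the Moufang identity $(ag)(ha)=(a(gh))a$ holds. Let $\Gamma=T_e(G)$ be its tangent algebra: in local coordinates centred at $e$ write $$(gh)^i=g^i+h^i+\sum_{j,k}a^i_{jk}\,g^jh^k+\cdots ,$$ where $a^i_{jk}=\partial^2(gh)^i/\partial g^j\partial h^k$ at $g=h=e$, and put $[x,y]^i=\sum_{j,k}(a^i_{jk}-a^i_{kj})x^jy^k$ for $x,y\in\Gamma$. Define the Yamaguti bracket $$[x,y,z]=[x,[y,z]]-[y,[x,z]]+[[x,y],z]$$ and, for $x,y\in\Gamma$, the linear operator $\hat Y(x;y)$ on $\Gamma$ (the Yamagutian) by $6\hat Y(x;y)z=[x,y,z]$. Then $\hat Y(x;y)$ is a derivation of the binary bracket of $\Gamma$: for all $x,y,z,w\in\Gamma$, $$\hat Y(x;y)[z,w]=[\hat Y(x;y)z,w]+[z,\hat Y(x;y)w].$$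 -/

import Mathlib

open scoped Manifold ContDiff Topology

/-- A local analytic Moufang loop on a finite-dimensional real analytic manifold `G`:
a point `one` together with a multiplication, a left division and a right division which are
defined and real analytic near `(one, one)` and satisfy the loop laws and the Moufang identity
for all arguments close enough to `one`. The operations are written as total functions; nothing
is required of their values away from `one`. -/
structure LocalAnalyticMoufangLoop (E : Type*) [NormedAddCommGroup E] [NormedSpace ℝ E]
    [FiniteDimensional ℝ E] (G : Type*) [TopologicalSpace G] [ChartedSpace E G]
    [IsManifold 𝓘(ℝ, E) ω G] where
  /-- the unit element -/
  one : G
  /-- the multiplication -/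
  mul : G → G → G
  /-- left division: `ldiv a b` is the solution `x` of `a x = b` -/
  ldiv : G → G → G
  /-- right division: `rdiv b a` is the solution `y` of `y a = b` -/
  rdiv : G → G → G
  analytic_mul : ContMDiffAt (𝓘(ℝ, E).prod 𝓘(ℝ, E)) 𝓘(ℝ, E) ω
    (fun p : G × G => mul p.1 p.2) (one, one)
  analytic_ldiv : ContMDiffAt (𝓘(ℝ, E).prod 𝓘(ℝ, E)) 𝓘(ℝ, E) ω
    (fun p : G × G => ldiv p.1 p.2) (one, one)
  analytic_rdiv : ContMDiffAt (𝓘(ℝ, E).prod 𝓘(ℝ, E)) 𝓘(ℝ, E) ω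
    (fun p : G × G => rdiv p.1 p.2) (one, one)
  one_mul : ∀ᶠ g in 𝓝 one, mul one g = g
  mul_one : ∀ᶠ g in 𝓝 one, mul g one = g
  mul_ldiv : ∀ᶠ p in 𝓝 (one, one), mul p.1 (ldiv p.1 p.2) = p.2
  ldiv_mul : ∀ᶠ p in 𝓝 (one, one), ldiv p.1 (mul p.1 p.2) = p.2
  rdiv_mul : ∀ᶠ p in 𝓝 (one, one), mul (rdiv p.1 p.2) p.2 = p.1
  mul_rdiv : ∀ᶠ p in 𝓝 (one, one), rdiv (mul p.1 p.2) p.2 = p.1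
  /-- the Moufang identity `(a g)(h a) = (a (g h)) a` -/
  moufang : ∀ᶠ p in 𝓝 (one, one, one),
    mul (mul p.1 p.2.1) (mul p.2.2 p.1) = mul (mul p.1 (mul p.2.1 p.2.2)) p.1

namespace LocalAnalyticMoufangLoop

variable {E : Type*} [NormedAddCommGroup E] [NormedSpace ℝ E] [FiniteDimensional ℝ E]
  {G : Type*} [TopologicalSpace G] [ChartedSpace E G] [IsManifold 𝓘(ℝ, E) ω G]

/-- The underlying vector space `Γ = T_e(G)` of the tangent algebra. -/
abbrev Tangent (M : LocalAnalyticMoufangLoop E G) : Type _ := TangentSpace 𝓘(ℝ, E) M.one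

/-- The multiplication in the preferred chart of `G` at the unit (the chart through which
Mathlib identifies `T_e(G)` with `E`). -/
noncomputable def chartMul (M : LocalAnalyticMoufangLoop E G) (u v : E) : E :=
  extChartAt 𝓘(ℝ, E) M.one
    (M.mul ((extChartAt 𝓘(ℝ, E) M.one).symm u) ((extChartAt 𝓘(ℝ, E) M.one).symm v))

/-- The mixed second derivative `a` of the multiplication at the unit: in coordinates centred at
the unit, `(g h)ⁱ = gⁱ + hⁱ + aⁱⱼₖ gʲ hᵏ + …`, and `mixed x y` has components `aⁱⱼₖ xʲ yᵏ`. -/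
noncomputable def mixed (M : LocalAnalyticMoufangLoop E G) : E →L[ℝ] E →L[ℝ] E :=
  fderiv ℝ (fun u => fderiv ℝ (fun v => M.chartMul u v) (extChartAt 𝓘(ℝ, E) M.one M.one))
    (extChartAt 𝓘(ℝ, E) M.one M.one)

/-- The binary bracket of the tangent algebra, with the structure constants
`cⁱⱼₖ = aⁱⱼₖ - aⁱₖⱼ`. -/
noncomputable def bracket (M : LocalAnalyticMoufangLoop E G) :
    M.Tangent →ₗ[ℝ] M.Tangent →ₗ[ℝ] M.Tangent :=
  LinearMap.mk₂ ℝ (M := E) (Nₗ := E) (Pₗ := E) (fun x y => M.mixed x y - M.mixed y x)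
    (fun x x' y => by simp only [map_add, add_apply]; abel)
    (fun c x y => by simp only [map_smul, smul_apply, smul_sub])
    (fun x y y' => by simp only [map_add, add_apply]; abel)
    (fun c x y => by simp only [map_smul, smul_apply, smul_sub])

/-- The Yamaguti bracket `[x,y,z] = [x,[y,z]] - [y,[x,z]] + [[x,y],z]`. -/
noncomputable def yamaguti (M : LocalAnalyticMoufangLoop E G) (x y z : M.Tangent) : M.Tangent :=
  M.bracket x (M.bracket y z) - M.bracket y (M.bracket x z) + M.bracket (M.bracket x y) z

/-- The Yamagutian `Ŷ(x;y)`, the linear operator on `Γ` with `6 Ŷ(x;y) z = [x,y,z]`. -/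
noncomputable def yamagutian (M : LocalAnalyticMoufangLoop E G) (x y : M.Tangent) :
    M.Tangent →ₗ[ℝ] M.Tangent where
  toFun z := (1 / 6 : ℝ) • M.yamaguti x y z
  map_add' z w := by
    simp only [yamaguti, map_add, ← smul_add]
    congr 1
    abel
  map_smul' c z := by
    simp only [yamaguti, map_smul, ← smul_sub, ← smul_add, RingHom.id_apply]
    rw [smul_comm]

end LocalAnalyticMoufangLoop

/-! Write L_x and R_x for the infinitesimal left and right translations. Differentiating the Moufang
identity in a at the unit shows that (L_x, R_x, L_x + R_x) is an infinitesimal autotopism. Setting g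
= e gives the flexible law, whose infinitesimal form is [L_x, R_x] = 0. Differentiating the
autotopism relation once more and antisymmetrising gives, together with its mirror image, [R_x, R_y]
= R_[x,y] - 2[L_x, R_y] and [L_x, L_y] = -L_[x,y] - 2[L_x, R_y] (`commutation_relations`).

For A = L - R and T = L + R these become [A_x, T_y] = -T_[x,y] and 3[T_x, T_y] = [A_x, A_y] -
2A_[x,y]. By the Jacobi identity for vector fields, 3[[T_y, T_z], T_w] = T_K(y,z,w) with K(y,z,w) =
[y,[z,w]] - [z,[y,w]] + 2[[y,z],w]. Bracketing with A_x is a derivation, and T_x(e) = 2x determines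
x, so each [x, ·] is a derivation of K (`ad_derivation_of_lieBracket`). The rest is linear algebra
in an anticommutative algebra (`yamaguti_derivation_of_ad_derivation`). -/

open VectorField Filter

/-! ### Anticommutative algebra: from the ternary product to the Yamagutian -/

/-- If every left multiplication of an anticommutative algebra is a derivation of the ternary
product `[y,[z,w]] - [z,[y,w]] + 2[[y,z],w]`, then the Yamaguti operators are derivations of the
binary product. -/
theorem yamaguti_derivation_of_ad_derivation {V : Type*} [AddCommGroup V] [Module ℝ V]
    (b : V →ₗ[ℝ] V →ₗ[ℝ] V) (hb : ∀ x y, b x y = -b y x)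
    (hK : ∀ x y z w,
      b x (b y (b z w) - b z (b y w) + (2 : ℝ) • b (b y z) w) =
        (b (b x y) (b z w) - b z (b (b x y) w) + (2 : ℝ) • b (b (b x y) z) w) +
        (b y (b (b x z) w) - b (b x z) (b y w) + (2 : ℝ) • b (b y (b x z)) w) +
        (b y (b z (b x w)) - b z (b y (b x w)) + (2 : ℝ) • b (b y z) (b x w)))
    (x y z w : V) :
    b x (b y (b z w)) - b y (b x (b z w)) + b (b x y) (b z w) =
      b (b x (b y z) - b y (b x z) + b (b x y) z) w +
      b z (b x (b y w) - b y (b x w) + b (b x y) w) := by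
  -- Since K is skew in its first two arguments, exchanging x and y swaps the first two instances
  -- and negates the third; the coefficients 1/4, -1/4, -3/4 below respect the skewness of the goal
  -- in x and y.
  have h₁ := hK x y z w
  have h₂ := hK y x z w
  have h₃ := hK z x y w
  -- Anticommutativity brings the nested monomials to right-normed form, so that only linear algebra
  -- remains.
  have flip₃ : ∀ p q r s, b (b p (b q r)) s = -b s (b p (b q r)) := fun p q r s => hb _ _
  have flip₂ : ∀ p q r s, b (b (b p q) r) s = b s (b r (b p q)) := fun p q r s => by
    rw [hb _ s, hb _ r, map_neg, neg_neg]
  have flip₁ : ∀ p q r s, b p (b (b q r) s) = -b p (b s (b q r)) := fun p q r s => by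
    rw [hb _ s, map_neg]
  simp only [map_add, map_sub, map_smul, LinearMap.add_apply, LinearMap.sub_apply, flip₃, flip₂,
    flip₁, hb z x, hb z y, hb y x, hb (b y z) (b x w), map_neg, LinearMap.neg_apply]
    at h₁ h₂ h₃ ⊢
  linear_combination (norm := module) (1 / 4 : ℝ) • h₁ - (1 / 4 : ℝ) • h₂ - (3 / 4 : ℝ) • h₃

/-! ### Infinitesimal translations of a unital analytic germ -/

section
variable {E : Type*} [NormedAddCommGroup E] [NormedSpace ℝ E]

/-- The infinitesimal left translation in the direction `x`. -/
noncomputable def leftField (m : E × E → E) (e x g : E) : E := fderiv ℝ m (e, g) (x, 0)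

/-- The infinitesimal right translation in the direction `x`. -/
noncomputable def rightField (m : E × E → E) (e x g : E) : E := fderiv ℝ m (g, e) (0, x)

/-- A germ of an analytic multiplication with unit `e`. -/
structure IsLocalUnital (m : E × E → E) (e : E) : Prop where
  contDiffAt : ContDiffAt ℝ ω m (e, e)
  left_unit : ∀ᶠ g in 𝓝 e, m (e, g) = g
  right_unit : ∀ᶠ g in 𝓝 e, m (g, e) = g

/-- A germ of an analytic multiplication with unit whose infinitesimal translations satisfy
the linearised Moufang identity and the linearised flexible law. -/
structure IsInfinitesimallyMoufang (m : E × E → E) (e : E) : Prop extends IsLocalUnital m e where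
  autotopism : ∀ᶠ p in 𝓝 (e, e), ∀ x,
    fderiv ℝ m p (leftField m e x p.1, rightField m e x p.2) =
      leftField m e x (m p) + rightField m e x (m p)
  lieBracket_left_right_self : ∀ᶠ g in 𝓝 e, ∀ x,
    lieBracket ℝ (leftField m e x) (rightField m e x) g = 0

theorem fderiv_comp_swap (m : E × E → E) (p v : E × E) :
    fderiv ℝ (m ∘ Prod.swap) p v = fderiv ℝ m p.swap v.swap := by
  have := (ContinuousLinearEquiv.prodComm ℝ E E).comp_right_fderiv (f := m) (x := p)
  exact DFunLike.congr_fun this v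

theorem leftField_comp_swap (m : E × E → E) (e : E) :
    leftField (m ∘ Prod.swap) e = rightField m e := by
  ext x g; simp [leftField, rightField, fderiv_comp_swap]

theorem rightField_comp_swap (m : E × E → E) (e : E) :
    rightField (m ∘ Prod.swap) e = leftField m e := by
  ext x g; simp [leftField, rightField, fderiv_comp_swap]

/-- Passing to the opposite multiplication exchanges L and R, and L + R is symmetric in them. Hence
each relation for right translations yields one for left translations. -/
theorem IsInfinitesimallyMoufang.comp_swap {m : E × E → E} {e : E}
    (h : IsInfinitesimallyMoufang m e) : IsInfinitesimallyMoufang (m ∘ Prod.swap) e where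
  contDiffAt := h.contDiffAt.comp (e, e) (contDiff_snd.prodMk contDiff_fst).contDiffAt
  left_unit := h.right_unit
  right_unit := h.left_unit
  autotopism := by
    have := (continuous_swap.tendsto (e, e)).eventually h.autotopism
    filter_upwards [this] with p hp x
    simpa [leftField_comp_swap, rightField_comp_swap, fderiv_comp_swap, add_comm] using hp x
  lieBracket_left_right_self := by
    filter_upwards [h.lieBracket_left_right_self] with g hg x
    rw [leftField_comp_swap, rightField_comp_swap, lieBracket_swap, hg x, neg_zero]

namespace IsLocalUnital
variable {m : E × E → E} {e : E}

theorem comp_swap (h : IsLocalUnital m e) : IsLocalUnital (m ∘ Prod.swap) e where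
  contDiffAt := h.contDiffAt.comp (e, e) (contDiff_snd.prodMk contDiff_fst).contDiffAt
  left_unit := h.right_unit
  right_unit := h.left_unit

theorem contDiffAt_rightField (h : IsLocalUnital m e) (x : E) :
    ContDiffAt ℝ ω (rightField m e x) e := by
  have h₁ : ContDiffAt ℝ ω (fderiv ℝ m) (e, e) := h.contDiffAt.fderiv_right le_rfl
  have h₂ : ContDiffAt ℝ ω (fun g : E => (g, e)) e := by fun_prop
  exact (ContDiffAt.comp (f := fun g : E => (g, e)) e h₁ h₂).clm_apply contDiffAt_const

theorem contDiffAt_leftField (h : IsLocalUnital m e) (x : E) :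
    ContDiffAt ℝ ω (leftField m e x) e := by
  simpa [rightField_comp_swap] using h.comp_swap.contDiffAt_rightField x

theorem eventually_contDiffAt_left (h : IsLocalUnital m e) :
    ∀ᶠ g in 𝓝 e, ContDiffAt ℝ ω m (e, g) :=
  (Continuous.tendsto (by fun_prop : Continuous fun g : E => (e, g)) e).eventually
    (h.contDiffAt.eventually (by simp))

theorem eventually_contDiffAt_right (h : IsLocalUnital m e) :
    ∀ᶠ g in 𝓝 e, ContDiffAt ℝ ω m (g, e) :=
  (Continuous.tendsto (by fun_prop : Continuous fun g : E => (g, e)) e).eventually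
    (h.contDiffAt.eventually (by simp))

theorem unit_mul_unit (h : IsLocalUnital m e) : m (e, e) = e := h.left_unit.self_of_nhds

end IsLocalUnital

theorem hasFDerivAt_rightField {m : E × E → E} {e g : E} (h : ContDiffAt ℝ ω m (g, e)) (x : E) :
    HasFDerivAt (rightField m e x)
      (((fderiv ℝ (fderiv ℝ m) (g, e)).flip (0, x)).comp (.inl ℝ E E)) g := by
  have h₁ : HasFDerivAt (fderiv ℝ m) (fderiv ℝ (fderiv ℝ m) (g, e)) (g, e) :=
    ((h.fderiv_right (m := ω) le_rfl).differentiableAt (by simp)).hasFDerivAt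
  have h₂ : HasFDerivAt (fun g : E => (g, e)) (.inl ℝ E E) g := hasFDerivAt_prodMk_left g e
  have h₃ := (HasFDerivAt.comp (f := fun g : E => (g, e)) g h₁ h₂).clm_apply
    (hasFDerivAt_const ((0 : E), x) g)
  refine h₃.congr_fderiv ?_
  ext v; simp

theorem fderiv_rightField {m : E × E → E} {e g : E} (h : ContDiffAt ℝ ω m (g, e)) (x v : E) :
    fderiv ℝ (rightField m e x) g v = fderiv ℝ (fderiv ℝ m) (g, e) (v, 0) (0, x) := by
  rw [(hasFDerivAt_rightField h x).fderiv]; rfl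

theorem hasFDerivAt_leftField {m : E × E → E} {e g : E} (h : ContDiffAt ℝ ω m (e, g)) (x : E) :
    HasFDerivAt (leftField m e x)
      (((fderiv ℝ (fderiv ℝ m) (e, g)).flip (x, 0)).comp (.inr ℝ E E)) g := by
  have h₁ : HasFDerivAt (fderiv ℝ m) (fderiv ℝ (fderiv ℝ m) (e, g)) (e, g) :=
    ((h.fderiv_right (m := ω) le_rfl).differentiableAt (by simp)).hasFDerivAt
  have h₂ : HasFDerivAt (fun g : E => (e, g)) (.inr ℝ E E) g := hasFDerivAt_prodMk_right e g
  have h₃ := (HasFDerivAt.comp (f := fun g : E => (e, g)) g h₁ h₂).clm_apply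
    (hasFDerivAt_const (x, (0 : E)) g)
  refine h₃.congr_fderiv ?_
  ext v; simp

theorem fderiv_leftField {m : E × E → E} {e g : E} (h : ContDiffAt ℝ ω m (e, g)) (x v : E) :
    fderiv ℝ (leftField m e x) g v = fderiv ℝ (fderiv ℝ m) (e, g) (0, v) (x, 0) := by
  rw [(hasFDerivAt_leftField h x).fderiv]; rfl

namespace IsLocalUnital
variable {m : E × E → E} {e : E}

theorem rightField_unit (h : IsLocalUnital m e) (x : E) : rightField m e x e = x := by
  have h₁ : HasFDerivAt (fun g : E => m (e, g)) ((fderiv ℝ m (e, e)).comp (.inr ℝ E E)) e :=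
    HasFDerivAt.comp (f := fun g : E => (e, g)) e
      (h.contDiffAt.differentiableAt (by simp)).hasFDerivAt (hasFDerivAt_prodMk_right e e)
  have h₂ : HasFDerivAt (fun g : E => m (e, g)) (.id ℝ E) e :=
    (hasFDerivAt_id e).congr_of_eventuallyEq h.left_unit
  exact DFunLike.congr_fun (h₁.unique h₂) x

theorem leftField_unit (h : IsLocalUnital m e) (x : E) : leftField m e x e = x := by
  simpa [rightField_comp_swap] using h.comp_swap.rightField_unit x

/-- The derivative of `m` in the first variable along the unit of the second one. -/
theorem eventually_fderiv_inl (h : IsLocalUnital m e) :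
    ∀ᶠ g in 𝓝 e, ∀ v, fderiv ℝ m (g, e) (v, 0) = v := by
  filter_upwards [h.right_unit.eventually_nhds, h.eventually_contDiffAt_right] with g hg hc v
  have h₁ : HasFDerivAt (fun g : E => m (g, e)) ((fderiv ℝ m (g, e)).comp (.inl ℝ E E)) g :=
    HasFDerivAt.comp (f := fun g : E => (g, e)) g
      (hc.differentiableAt (by simp)).hasFDerivAt (hasFDerivAt_prodMk_left g e)
  have h₂ : HasFDerivAt (fun g : E => m (g, e)) (.id ℝ E) g :=
    (hasFDerivAt_id g).congr_of_eventuallyEq hg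
  exact DFunLike.congr_fun (h₁.unique h₂) v

end IsLocalUnital
end

/-! ### Commutation relations from the linearised Moufang identity -/

section
variable {E : Type*} [NormedAddCommGroup E] [NormedSpace ℝ E] {m : E × E → E} {e : E}

/-- The mixed second derivative of a multiplication at the unit. -/
noncomputable def mixedSecond (m : E × E → E) (e x y : E) : E :=
  fderiv ℝ (fderiv ℝ m) (e, e) (x, 0) (0, y)

theorem leftField_add (x y : E) :
    leftField m e (x + y) = leftField m e x + leftField m e y := by
  ext g
  simp only [leftField, Pi.add_apply, ← map_add, Prod.mk_add_mk, add_zero]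

theorem leftField_smul (c : ℝ) (x : E) : leftField m e (c • x) = c • leftField m e x := by
  ext g
  simp only [leftField, Pi.smul_apply, ← map_smul, Prod.smul_mk, smul_zero]

theorem rightField_add (x y : E) :
    rightField m e (x + y) = rightField m e x + rightField m e y := by
  simpa [leftField_comp_swap] using leftField_add (m := m ∘ Prod.swap) (e := e) x y

theorem rightField_smul (c : ℝ) (x : E) : rightField m e (c • x) = c • rightField m e x := by
  simpa [leftField_comp_swap] using leftField_smul (m := m ∘ Prod.swap) (e := e) c x

theorem IsLocalUnital.symm_snd (h : IsLocalUnital m e) (u v : E × E) :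
    fderiv ℝ (fderiv ℝ m) (e, e) u v = fderiv ℝ (fderiv ℝ m) (e, e) v u :=
  h.contDiffAt.isSymmSndFDerivAt_of_omega u v

theorem IsLocalUnital.mixedSecond_comp_swap (h : IsLocalUnital m e) (x y : E) :
    mixedSecond (m ∘ Prod.swap) e x y = mixedSecond m e y x := by
  have h₁ := fderiv_leftField (m := m ∘ Prod.swap) h.comp_swap.contDiffAt x y
  rw [leftField_comp_swap, fderiv_rightField h.contDiffAt, h.comp_swap.symm_snd] at h₁
  exact h₁.symm

theorem IsLocalUnital.fderiv_rightField_unit (h : IsLocalUnital m e) (x v : E) :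
    fderiv ℝ (rightField m e x) e v = mixedSecond m e v x :=
  fderiv_rightField h.contDiffAt x v

/-- The derivative of the linearised Moufang identity in its second argument at the unit. -/
theorem IsInfinitesimallyMoufang.fderiv_autotopism (h : IsInfinitesimallyMoufang m e) :
    ∀ᶠ g in 𝓝 e, ∀ x y,
      fderiv ℝ (fderiv ℝ m) (g, e) (0, y) (0, x) + fderiv ℝ (rightField m e y) g (leftField m e x g)
        + rightField m e (mixedSecond m e y x) g =
      fderiv ℝ (leftField m e x) g (rightField m e y g)
        + fderiv ℝ (rightField m e x) g (rightField m e y g) := by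
  have hι : Tendsto (fun g : E => (g, e)) (𝓝 e) (𝓝 (e, e)) :=
    Continuous.tendsto (by fun_prop : Continuous fun g : E => (g, e)) e
  filter_upwards [hι.eventually h.autotopism.eventually_nhds, h.eventually_contDiffAt_right,
    h.eventually_contDiffAt_left, h.right_unit] with g ha hr hl hg x y
  have hD : HasFDerivAt (fderiv ℝ m) (fderiv ℝ (fderiv ℝ m) (g, e)) (g, e) :=
    ((hr.fderiv_right (m := ω) le_rfl).differentiableAt (by simp)).hasFDerivAt
  have hι' : HasFDerivAt (fun k : E => (g, k)) (.inr ℝ E E) e := hasFDerivAt_prodMk_right g e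
  have hR : HasFDerivAt (rightField m e x) (fderiv ℝ (rightField m e x) e) e :=
    ((h.contDiffAt_rightField x).differentiableAt (by simp)).hasFDerivAt
  have hlhs := (HasFDerivAt.comp (f := fun k : E => (g, k)) e hD hι').clm_apply
    ((hasFDerivAt_const (leftField m e x g) e).prodMk hR)
  have hm : HasFDerivAt (fun k => m (g, k)) ((fderiv ℝ m (g, e)).comp (.inr ℝ E E)) e :=
    HasFDerivAt.comp (f := fun k : E => (g, k)) e
      (hr.differentiableAt (by simp)).hasFDerivAt hι'
  have hT : HasFDerivAt (fun k => leftField m e x k + rightField m e x k)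
      (fderiv ℝ (leftField m e x) g + fderiv ℝ (rightField m e x) g) (m (g, e)) := by
    rw [hg]
    exact (hasFDerivAt_leftField hl x).differentiableAt.hasFDerivAt.add
      (hasFDerivAt_rightField hr x).differentiableAt.hasFDerivAt
  have hrhs := hT.comp e hm
  have heq : (fun k => fderiv ℝ m (g, k) (leftField m e x g, rightField m e x k)) =ᶠ[𝓝 e]
      fun k => leftField m e x (m (g, k)) + rightField m e x (m (g, k)) :=
    ((Continuous.tendsto (by fun_prop : Continuous fun k : E => (g, k)) e).eventually ha).mono
      fun k hk => hk x
  have key := DFunLike.congr_fun (hlhs.unique (hrhs.congr_of_eventuallyEq heq)) y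
  simp only [add_apply, ContinuousLinearMap.comp_apply,
    ContinuousLinearMap.flip_apply, ContinuousLinearMap.inr_apply, Function.comp_apply,
    ContinuousLinearMap.prod_apply, zero_apply,
    h.rightField_unit, h.fderiv_rightField_unit] at key
  -- By symmetry of the second derivative the summand (L_x g, 0) gives the derivative of R_y along
  -- L_x; (0, x) leaves a pure second derivative in the second variable.
  have hsplit : ((leftField m e x g, x) : E × E) = (leftField m e x g, 0) + (0, x) := by simp
  rw [hsplit, map_add, hr.isSymmSndFDerivAt_of_omega (0, y) (leftField m e x g, 0),
    ← fderiv_rightField hr] at key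
  have hfold : ∀ v, fderiv ℝ m (g, e) (0, v) = rightField m e v g := fun _ => rfl
  simp only [hfold] at key
  rw [← key]
  abel

/-- The commutation relation of infinitesimal right translations. -/
theorem IsInfinitesimallyMoufang.lieBracket_right_right (h : IsInfinitesimallyMoufang m e) :
    ∀ᶠ g in 𝓝 e, ∀ x y,
      lieBracket ℝ (rightField m e x) (rightField m e y) g
        + lieBracket ℝ (leftField m e x) (rightField m e y) g
        - lieBracket ℝ (leftField m e y) (rightField m e x) g =
      rightField m e (mixedSecond m e x y - mixedSecond m e y x) g := by
  filter_upwards [h.fderiv_autotopism, h.eventually_contDiffAt_right] with g hg hr x y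
  have h₁ := hg x y
  have h₂ := hg y x
  -- The pure second derivative is symmetric in x and y, so it cancels in the difference.
  have hs := hr.isSymmSndFDerivAt_of_omega (0, x) (0, y)
  have hsub : rightField m e (mixedSecond m e x y - mixedSecond m e y x) g =
      rightField m e (mixedSecond m e x y) g - rightField m e (mixedSecond m e y x) g := by
    simp [rightField, ← map_sub]
  rw [hs] at h₂
  rw [hsub]
  simp only [lieBracket]
  linear_combination (norm := module) h₁ - h₂

/-- Polarisation of [L_x, R_x] = 0 at x + y. -/
theorem IsInfinitesimallyMoufang.lieBracket_left_right_comm (h : IsInfinitesimallyMoufang m e) :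
    ∀ᶠ g in 𝓝 e, ∀ x y,
      lieBracket ℝ (leftField m e y) (rightField m e x) g =
        -lieBracket ℝ (leftField m e x) (rightField m e y) g := by
  filter_upwards [h.lieBracket_left_right_self, h.eventually_contDiffAt_right,
    h.eventually_contDiffAt_left] with g hg hr hl x y
  have dl := fun x => (hasFDerivAt_leftField hl x).differentiableAt
  have dr := fun x => (hasFDerivAt_rightField hr x).differentiableAt
  have h₁ := hg (x + y)
  rw [leftField_add, rightField_add, lieBracket_add_left (dl x) (dl y),
    lieBracket_add_right (dr x) (dr y), lieBracket_add_right (dr x) (dr y), hg x, hg y] at h₁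
  simpa [eq_neg_iff_add_eq_zero, add_comm] using h₁
end

/-! ### The fields L - R and L + R and their triple brackets -/

section
variable {E : Type*} [NormedAddCommGroup E] [NormedSpace ℝ E] {e : E}

theorem ContDiffAt.eventually_differentiableAt {V : E → E} (hV : ContDiffAt ℝ ω V e) :
    ∀ᶠ g in 𝓝 e, DifferentiableAt ℝ V g :=
  (hV.eventually (by simp)).mono fun _ h => h.differentiableAt (by simp)

/-- Bracket identities are needed as equalities of germs, because they are substituted into further
brackets, which differentiate the fields. -/
theorem eventuallyEq_lieBracket_add_left {V V' : E → E} (W : E → E) (hV : ContDiffAt ℝ ω V e)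
    (hV' : ContDiffAt ℝ ω V' e) :
    lieBracket ℝ (V + V') W =ᶠ[𝓝 e] lieBracket ℝ V W + lieBracket ℝ V' W := by
  filter_upwards [hV.eventually_differentiableAt, hV'.eventually_differentiableAt] with g h h'
  exact lieBracket_add_left h h'

theorem eventuallyEq_lieBracket_smul_left (c : ℝ) {V : E → E} (W : E → E)
    (hV : ContDiffAt ℝ ω V e) :
    lieBracket ℝ (c • V) W =ᶠ[𝓝 e] c • lieBracket ℝ V W := by
  filter_upwards [hV.eventually_differentiableAt] with g h
  exact lieBracket_const_smul_left h

theorem eventuallyEq_lieBracket_smul_right (c : ℝ) (V : E → E) {W : E → E}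
    (hW : ContDiffAt ℝ ω W e) :
    lieBracket ℝ V (c • W) =ᶠ[𝓝 e] c • lieBracket ℝ V W := by
  filter_upwards [hW.eventually_differentiableAt] with g h
  exact lieBracket_const_smul_right h

theorem eventuallyEq_leibniz_lieBracket [CompleteSpace E] {U V W : E → E}
    (hU : ContDiffAt ℝ ω U e) (hV : ContDiffAt ℝ ω V e) (hW : ContDiffAt ℝ ω W e) :
    lieBracket ℝ U (lieBracket ℝ V W) =ᶠ[𝓝 e]
      lieBracket ℝ (lieBracket ℝ U V) W + lieBracket ℝ V (lieBracket ℝ U W) := by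
  filter_upwards [hU.eventually (by simp), hV.eventually (by simp),
    hW.eventually (by simp)] with g h₁ h₂ h₃
  exact leibniz_identity_lieBracket le_top h₁ h₂ h₃

/-- Vector fields `A x`, `T x` with `[A x, T y] = -T [x, y]` and
`3 [T x, T y] = [A x, A y] - 2 A [x, y]` force the maps `[x, ·]` to be derivations of the ternary
product `[y,[z,w]] - [z,[y,w]] + 2[[y,z],w]`. -/
theorem ad_derivation_of_lieBracket [CompleteSpace E] (b : E →ₗ[ℝ] E →ₗ[ℝ] E)
    (A T : E →ₗ[ℝ] E → E) (hA : ∀ x, ContDiffAt ℝ ω (A x) e) (hT : ∀ x, ContDiffAt ℝ ω (T x) e)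
    (hTe : Function.Injective fun x => T x e)
    (hAT : ∀ x y, lieBracket ℝ (A x) (T y) =ᶠ[𝓝 e] T (-b x y))
    (hTT : ∀ x y, (3 : ℝ) • lieBracket ℝ (T x) (T y) =ᶠ[𝓝 e]
      lieBracket ℝ (A x) (A y) + A (-((2 : ℝ) • b x y))) (x y z w : E) :
    b x (b y (b z w) - b z (b y w) + (2 : ℝ) • b (b y z) w) =
      (b (b x y) (b z w) - b z (b (b x y) w) + (2 : ℝ) • b (b (b x y) z) w) +
      (b y (b (b x z) w) - b (b x z) (b y w) + (2 : ℝ) • b (b y (b x z)) w) +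
      (b y (b z (b x w)) - b z (b y (b x w)) + (2 : ℝ) • b (b y z) (b x w)) := by
  have hbr : ∀ {V W : E → E}, ContDiffAt ℝ ω V e → ContDiffAt ℝ ω W e →
      ContDiffAt ℝ ω (lieBracket ℝ V W) e := fun hV hW => hV.lieBracket_vectorField hW le_rfl
  have rfl' : ∀ V : E → E, V =ᶠ[𝓝 e] V := fun V => EventuallyEq.rfl
  -- Jacobi: the bracket of A_x and A_y acts on the T's as the commutator of their actions.
  have hAAT : ∀ x y z, lieBracket ℝ (lieBracket ℝ (A x) (A y)) (T z) =ᶠ[𝓝 e]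
      T (b x (b y z) - b y (b x z)) := by
    intro x y z
    filter_upwards [eventuallyEq_leibniz_lieBracket (hA x) (hA y) (hT z),
      ((rfl' (A x)).lieBracket_vectorField (𝕜 := ℝ) (hAT y z)).trans (hAT _ _),
      ((rfl' (A y)).lieBracket_vectorField (𝕜 := ℝ) (hAT x z)).trans (hAT _ _)] with g h₁ h₂ h₃
    rw [Pi.add_apply, h₂, h₃] at h₁
    rw [eq_sub_of_add_eq h₁.symm]
    simp
  have hTTT : ∀ y z w, (3 : ℝ) • lieBracket ℝ (lieBracket ℝ (T y) (T z)) (T w) =ᶠ[𝓝 e]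
      T (b y (b z w) - b z (b y w) + (2 : ℝ) • b (b y z) w) := by
    intro y z w
    filter_upwards [eventuallyEq_lieBracket_smul_left 3 (T w) (hbr (hT y) (hT z)),
      (hTT y z).lieBracket_vectorField (𝕜 := ℝ) (rfl' (T w)),
      eventuallyEq_lieBracket_add_left (T w) (hbr (hA y) (hA z)) (hA (-((2 : ℝ) • b y z))),
      hAAT y z w, hAT (-((2 : ℝ) • b y z)) w] with g h₁ h₂ h₃ h₄ h₅
    rw [← h₁, h₂, h₃, Pi.add_apply, h₄, h₅]
    simp
  have hATT : lieBracket ℝ (A x) (lieBracket ℝ (T y) (T z)) =ᶠ[𝓝 e]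
      lieBracket ℝ (T (-b x y)) (T z) + lieBracket ℝ (T y) (T (-b x z)) :=
    (eventuallyEq_leibniz_lieBracket (hA x) (hT y) (hT z)).trans
      (((hAT x y).lieBracket_vectorField (𝕜 := ℝ) (rfl' _)).add
        ((rfl' _).lieBracket_vectorField (𝕜 := ℝ) (hAT x z)))
  have h₁ := (eventuallyEq_leibniz_lieBracket (hA x) (hbr (hT y) (hT z)) (hT w)).self_of_nhds
  have h₂ := ((eventuallyEq_lieBracket_smul_right 3 (A x) (hbr (hbr (hT y) (hT z)) (hT w))).symm.trans
    (((rfl' (A x)).lieBracket_vectorField (𝕜 := ℝ) (hTTT y z w)).trans (hAT _ _))).self_of_nhds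
  have h₃ := ((hATT.lieBracket_vectorField (𝕜 := ℝ) (rfl' (T w))).trans
    (eventuallyEq_lieBracket_add_left (T w) (hbr (hT _) (hT _)) (hbr (hT _) (hT _)))).self_of_nhds
  have h₄ := ((rfl' (lieBracket ℝ (T y) (T z))).lieBracket_vectorField (𝕜 := ℝ) (hAT x w)).self_of_nhds
  have h₅ := (hTTT (-b x y) z w).self_of_nhds
  have h₆ := (hTTT y (-b x z) w).self_of_nhds
  have h₇ := (hTTT y z (-b x w)).self_of_nhds
  -- The sign arises because A_x acts on the T's through -[x, ·].
  apply neg_injective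
  apply hTe
  simp only [Pi.add_apply, Pi.smul_apply] at h₁ h₂ h₃ h₄ h₅ h₆ h₇
  beta_reduce
  rw [← h₂, h₁, h₃, h₄, smul_add, smul_add, h₅, h₆, h₇, ← Pi.add_apply, ← Pi.add_apply,
    ← map_add, ← map_add]
  refine congrFun (congrArg T ?_) e
  simp only [map_neg, LinearMap.neg_apply, smul_neg]
  abel

variable {m : E × E → E}

/-- The vector fields `L x - R x`, linear in `x`. -/
noncomputable def diffField (m : E × E → E) (e : E) : E →ₗ[ℝ] E → E where
  toFun x := leftField m e x - rightField m e x
  map_add' x y := by rw [leftField_add, rightField_add]; abel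
  map_smul' c x := by rw [leftField_smul, rightField_smul, ← smul_sub, RingHom.id_apply]

/-- The vector fields `L x + R x`, linear in `x`. -/
noncomputable def sumField (m : E × E → E) (e : E) : E →ₗ[ℝ] E → E where
  toFun x := leftField m e x + rightField m e x
  map_add' x y := by rw [leftField_add, rightField_add]; abel
  map_smul' c x := by rw [leftField_smul, rightField_smul, ← smul_add, RingHom.id_apply]

/-- The commutation relations of infinitesimal left and right translations, all solved for
brackets of left with right translations. -/
theorem IsInfinitesimallyMoufang.commutation_relations (h : IsInfinitesimallyMoufang m e) :
    ∀ᶠ g in 𝓝 e, ∀ x y,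
      lieBracket ℝ (leftField m e y) (rightField m e x) g =
        -lieBracket ℝ (leftField m e x) (rightField m e y) g ∧
      lieBracket ℝ (rightField m e x) (rightField m e y) g =
        rightField m e (mixedSecond m e x y - mixedSecond m e y x) g -
          (2 : ℝ) • lieBracket ℝ (leftField m e x) (rightField m e y) g ∧
      lieBracket ℝ (leftField m e x) (leftField m e y) g =
        -leftField m e (mixedSecond m e x y - mixedSecond m e y x) g -
          (2 : ℝ) • lieBracket ℝ (leftField m e x) (rightField m e y) g := by
  filter_upwards [h.lieBracket_left_right_comm, h.lieBracket_right_right,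
    h.comp_swap.lieBracket_right_right] with g h₁ h₂ h₃ x y
  -- The right-right relation of the opposite multiplication is the left-left relation of m, with
  -- the tangent bracket negated.
  simp only [leftField_comp_swap, rightField_comp_swap, h.mixedSecond_comp_swap] at h₃
  have h₂' := h₂ x y
  have h₃' := h₃ x y
  have hneg : leftField m e (mixedSecond m e y x - mixedSecond m e x y) g =
      -leftField m e (mixedSecond m e x y - mixedSecond m e y x) g := by
    rw [← neg_sub, ← neg_one_smul ℝ, leftField_smul]; simp
  rw [lieBracket_swap (V := rightField m e x), lieBracket_swap (V := rightField m e y), h₁ x y,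
    hneg] at h₃'
  rw [h₁ x y] at h₂'
  refine ⟨h₁ x y, ?_, ?_⟩
  · linear_combination (norm := module) h₂'
  · linear_combination (norm := module) h₃'

theorem IsInfinitesimallyMoufang.ad_derivation [CompleteSpace E]
    (h : IsInfinitesimallyMoufang m e) (b : E →ₗ[ℝ] E →ₗ[ℝ] E)
    (hb : ∀ x y, b x y = mixedSecond m e x y - mixedSecond m e y x) (x y z w : E) :
    b x (b y (b z w) - b z (b y w) + (2 : ℝ) • b (b y z) w) =
      (b (b x y) (b z w) - b z (b (b x y) w) + (2 : ℝ) • b (b (b x y) z) w) +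
      (b y (b (b x z) w) - b (b x z) (b y w) + (2 : ℝ) • b (b y (b x z)) w) +
      (b y (b z (b x w)) - b z (b y (b x w)) + (2 : ℝ) • b (b y z) (b x w)) := by
  have hL := h.contDiffAt_leftField
  have hR := h.contDiffAt_rightField
  refine ad_derivation_of_lieBracket (e := e) b (diffField m e) (sumField m e)
    (fun x => (hL x).sub (hR x)) (fun x => (hL x).add (hR x)) ?_ ?_ ?_ x y z w
  -- At the unit L_u and R_u both equal u, so the sum field takes the value 2u.
  · intro u v huv
    change leftField m e u e + rightField m e u e = leftField m e v e + rightField m e v e at huv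
    rw [h.leftField_unit, h.rightField_unit, h.leftField_unit, h.rightField_unit,
      ← two_smul ℝ, ← two_smul ℝ] at huv
    exact smul_right_injective E two_ne_zero huv
  all_goals
    intro x y
    filter_upwards [h.commutation_relations, (hL x).eventually_differentiableAt,
      (hR x).eventually_differentiableAt, (hL y).eventually_differentiableAt,
      (hR y).eventually_differentiableAt] with g hg lx rx ly ry
    obtain ⟨h₁, h₂, h₃⟩ := hg x y
    rw [← hb] at h₂ h₃
    simp only [lieBracket] at h₁ h₂ h₃
    simp only [map_neg, map_smul, Pi.neg_apply, Pi.add_apply, Pi.smul_apply, sumField, diffField,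
      LinearMap.coe_mk, AddHom.coe_mk, lieBracket, fderiv_add lx rx, fderiv_add ly ry,
      fderiv_sub lx rx, fderiv_sub ly ry, Pi.sub_apply, map_add, map_sub, add_apply, sub_apply]
  · linear_combination (norm := module) h₃ - h₂ + h₁
  · linear_combination (norm := module) (2 : ℝ) • h₃ + (2 : ℝ) • h₂ - (4 : ℝ) • h₁
end

/-! ### From the Moufang identity to its infinitesimal form -/

section
variable {E : Type*} [NormedAddCommGroup E] [NormedSpace ℝ E] {m : E × E → E} {e : E}

/-- If a function of two variables vanishes on the axes and on the diagonal, then so does its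
mixed second derivative at the origin. -/
theorem fderiv_fderiv_eq_zero_of_axes_diagonal {φ : ℝ × ℝ → E} (hφ : ContDiffAt ℝ ω φ 0)
    (h₁ : ∀ᶠ t : ℝ in 𝓝 0, φ (t, 0) = 0) (h₂ : ∀ᶠ t : ℝ in 𝓝 0, φ (0, t) = 0)
    (h₃ : ∀ᶠ t : ℝ in 𝓝 0, φ (t, t) = 0) :
    fderiv ℝ (fderiv ℝ φ) 0 (1, 0) (0, 1) = 0 := by
  have key : ∀ v : ℝ × ℝ, (∀ᶠ t : ℝ in 𝓝 0, φ (t • v) = 0) →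
      fderiv ℝ (fderiv ℝ φ) 0 v v = 0 := by
    intro v hv
    have hι : HasDerivAt (fun t : ℝ => t • v) v 0 := by
      simpa using (hasDerivAt_id (0 : ℝ)).smul_const v
    have hc : Tendsto (fun t : ℝ => t • v) (𝓝 0) (𝓝 0) := by
      simpa using hι.continuousAt.tendsto
    have hfirst : ∀ᶠ t : ℝ in 𝓝 0, fderiv ℝ φ (t • v) v = 0 := by
      filter_upwards [hv.eventually_nhds, hc.eventually (hφ.eventually (by simp))] with t ht hφt
      have hd : HasDerivAt (fun t : ℝ => t • v) v t := by
        simpa using (hasDerivAt_id t).smul_const v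
      have := (hφt.differentiableAt (by simp)).hasFDerivAt.comp_hasDerivAt t hd
      exact this.unique ((hasDerivAt_const t (0 : E)).congr_of_eventuallyEq ht)
    have hD : HasFDerivAt (fderiv ℝ φ) (fderiv ℝ (fderiv ℝ φ) 0) ((0 : ℝ) • v) := by
      rw [zero_smul]
      exact ((hφ.fderiv_right (m := ω) le_rfl).differentiableAt (by simp)).hasFDerivAt
    have hD' : HasDerivAt (fun t : ℝ => fderiv ℝ φ (t • v)) (fderiv ℝ (fderiv ℝ φ) 0 v) 0 :=
      HasFDerivAt.comp_hasDerivAt (f := fun t : ℝ => t • v) 0 hD hι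
    have h : HasDerivAt (fun t : ℝ => fderiv ℝ φ (t • v) v) _ 0 :=
      hD'.clm_apply (hasDerivAt_const (0 : ℝ) v)
    rw [map_zero, add_zero] at h
    exact h.unique ((hasDerivAt_const (0 : ℝ) (0 : E)).congr_of_eventuallyEq hfirst)
  have k₁ := key (1, 0) (by simpa using h₁)
  have k₂ := key (0, 1) (by simpa using h₂)
  -- Polarisation: the quadratic form vanishes on both axes and on the diagonal, so twice the mixed
  -- term is zero.
  have k₃ := key ((1, 0) + (0, 1)) (by simpa using h₃)
  simp only [map_add, add_apply] at k₃
  rw [k₁, k₂,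
    hφ.isSymmSndFDerivAt_of_omega (0, 1) (1, 0), zero_add, add_zero, ← two_smul ℝ] at k₃
  exact (smul_eq_zero.mp k₃).resolve_left two_ne_zero

/-- The mixed second derivative at the origin, computed one variable at a time. -/
theorem fderiv_fderiv_mixed {φ : ℝ × ℝ → E} (hφ : ContDiffAt ℝ ω φ 0) {ψ : ℝ → E} {c : E}
    (hψ : ∀ᶠ s : ℝ in 𝓝 0, HasDerivAt (fun t => φ (s, t)) (ψ s) 0) (hc : HasDerivAt ψ c 0) :
    fderiv ℝ (fderiv ℝ φ) 0 (1, 0) (0, 1) = c := by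
  have hι : Tendsto (fun s : ℝ => (s, (0 : ℝ))) (𝓝 0) (𝓝 0) :=
    Continuous.tendsto (by fun_prop : Continuous fun s : ℝ => (s, (0 : ℝ))) 0
  have hψ' : (fun s : ℝ => fderiv ℝ φ (s, 0) (0, 1)) =ᶠ[𝓝 0] ψ := by
    filter_upwards [hψ, hι.eventually (hφ.eventually (by simp))] with s hs hφs
    have hd : HasDerivAt (fun t : ℝ => (s, t)) (0, 1) 0 :=
      (hasDerivAt_const (0 : ℝ) s).prodMk (hasDerivAt_id (0 : ℝ))
    exact (HasFDerivAt.comp_hasDerivAt (f := fun t : ℝ => (s, t)) 0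
      (hφs.differentiableAt (by simp)).hasFDerivAt hd).unique hs
  have hD : HasFDerivAt (fderiv ℝ φ) (fderiv ℝ (fderiv ℝ φ) 0) ((0 : ℝ), (0 : ℝ)) :=
    ((hφ.fderiv_right (m := ω) le_rfl).differentiableAt (by simp)).hasFDerivAt
  have hD' : HasDerivAt (fun s : ℝ => fderiv ℝ φ (s, 0)) (fderiv ℝ (fderiv ℝ φ) 0 (1, 0)) 0 :=
    HasFDerivAt.comp_hasDerivAt (f := fun s : ℝ => (s, (0 : ℝ))) 0 hD
      ((hasDerivAt_id (0 : ℝ)).prodMk (hasDerivAt_const (0 : ℝ) (0 : ℝ)))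
  have h : HasDerivAt (fun s : ℝ => fderiv ℝ φ (s, 0) (0, 1)) _ 0 :=
    hD'.clm_apply (hasDerivAt_const (0 : ℝ) ((0 : ℝ), (1 : ℝ)))
  rw [map_zero, add_zero] at h
  exact h.unique (hc.congr_of_eventuallyEq hψ')

/-- A germ of an analytic multiplication with unit satisfying the Moufang identity. -/
structure IsLocalMoufang (m : E × E → E) (e : E) : Prop extends IsLocalUnital m e where
  moufang : ∀ᶠ p in 𝓝 (e, e, e),
    m (m (p.1, p.2.1), m (p.2.2, p.1)) = m (m (p.1, m (p.2.1, p.2.2)), p.1)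

namespace IsLocalMoufang

/-- With g and h fixed, the identity holds on a whole neighbourhood of a = e, so it may be
differentiated in a there. -/
theorem eventually_moufang (h : IsLocalMoufang m e) :
    ∀ᶠ p in 𝓝 (e, e), ∀ᶠ a in 𝓝 e,
      m (m (a, p.1), m (p.2, a)) = m (m (a, m (p.1, p.2)), a) := by
  have hc : Tendsto (fun q : (E × E) × E => (q.2, q.1.1, q.1.2)) (𝓝 ((e, e), e))
      (𝓝 (e, e, e)) :=
    Continuous.tendsto (by fun_prop : Continuous fun q : (E × E) × E => (q.2, q.1.1, q.1.2)) _
  have := hc.eventually h.moufang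
  rw [nhds_prod_eq] at this
  exact this.curry

/-- The Moufang identity with g = e. -/
theorem eventually_flexible (h : IsLocalMoufang m e) :
    ∀ᶠ p in 𝓝 (e, e), m (p.1, m (p.2, p.1)) = m (m (p.1, p.2), p.1) := by
  have hc : Tendsto (fun p : E × E => (p.1, e, p.2)) (𝓝 (e, e)) (𝓝 (e, e, e)) :=
    Continuous.tendsto (by fun_prop : Continuous fun p : E × E => (p.1, e, p.2)) _
  filter_upwards [hc.eventually h.moufang, continuousAt_fst.eventually h.right_unit,
    continuousAt_snd.eventually h.left_unit] with p hp h₁ h₂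
  rwa [h₁, h₂] at hp

/-- Differentiate the Moufang identity in a at e. On the right a occurs twice: the inner factor
contributes L_x(gh), because right multiplication by e is the identity, and the outer one
contributes R_x(gh). -/
theorem eventually_autotopism (h : IsLocalMoufang m e) :
    ∀ᶠ p in 𝓝 (e, e), ∀ x,
      fderiv ℝ m p (leftField m e x p.1, rightField m e x p.2) =
        leftField m e x (m p) + rightField m e x (m p) := by
  have hm : Tendsto m (𝓝 (e, e)) (𝓝 e) := by
    simpa [h.unit_mul_unit] using h.contDiffAt.continuousAt.tendsto
  have hfst : Tendsto Prod.fst (𝓝 (e, e)) (𝓝 e) := continuousAt_fst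
  have hsnd : Tendsto Prod.snd (𝓝 (e, e)) (𝓝 e) := continuousAt_snd
  filter_upwards [h.eventually_moufang, h.contDiffAt.eventually (by simp),
    hfst.eventually h.eventually_contDiffAt_left, hsnd.eventually h.eventually_contDiffAt_right,
    hm.eventually h.eventually_contDiffAt_left, hm.eventually h.eventually_contDiffAt_right,
    hfst.eventually h.left_unit, hsnd.eventually h.right_unit, hm.eventually h.left_unit,
    hm.eventually h.eventually_fderiv_inl]
    with ⟨g, k⟩ hM hgk hl hr hlm hrm ug uk um hinl x
  have dl : ∀ {q : E}, ContDiffAt ℝ ω m (e, q) → HasFDerivAt (fun a => m (a, q))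
      ((fderiv ℝ m (e, q)).comp (.inl ℝ E E)) e := fun {q} hq =>
    HasFDerivAt.comp (f := fun a : E => (a, q)) e
      (hq.differentiableAt (by simp)).hasFDerivAt (hasFDerivAt_prodMk_left e q)
  have dr : HasFDerivAt (fun a => m (k, a)) ((fderiv ℝ m (k, e)).comp (.inr ℝ E E)) e :=
    HasFDerivAt.comp (f := fun a : E => (k, a)) e
      (hr.differentiableAt (by simp)).hasFDerivAt (hasFDerivAt_prodMk_right k e)
  have hout : HasFDerivAt m (fderiv ℝ m (g, k)) (m (e, g), m (k, e)) := by
    simp only at ug uk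
    rw [ug, uk]; exact (hgk.differentiableAt (by simp)).hasFDerivAt
  have hout' : HasFDerivAt m (fderiv ℝ m (m (g, k), e)) (m (e, m (g, k)), e) := by
    rw [um]; exact (hrm.differentiableAt (by simp)).hasFDerivAt
  have hlhs := HasFDerivAt.comp (f := fun a => (m (a, g), m (k, a))) e hout ((dl hl).prodMk dr)
  have hrhs := HasFDerivAt.comp (f := fun a => (m (a, m (g, k)), a)) e hout'
    ((dl hlm).prodMk (hasFDerivAt_id e))
  have key := DFunLike.congr_fun (hlhs.unique (hrhs.congr_of_eventuallyEq hM)) x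
  change fderiv ℝ m (g, k) (leftField m e x g, rightField m e x k) =
    fderiv ℝ m (m (g, k), e) (leftField m e x (m (g, k)), x) at key
  have hsplit : (leftField m e x (m (g, k)), x) = (leftField m e x (m (g, k)), 0) + (0, x) := by
    simp
  rw [hsplit, map_add, hinl] at key
  exact key

/-- Along a line c through e with direction x, the associator c(s)(g c(t)) - (c(s)g)c(t) vanishes on
the axes by the unit laws and on the diagonal by flexibility. Its mixed derivative is therefore
zero, and that derivative is -[L_x, R_x] at g. -/
theorem eventually_lieBracket_left_right_self (h : IsLocalMoufang m e) :
    ∀ᶠ g in 𝓝 e, ∀ x, lieBracket ℝ (leftField m e x) (rightField m e x) g = 0 := by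
  have hflex : ∀ᶠ g in 𝓝 e, ∀ᶠ a in 𝓝 e, m (a, m (g, a)) = m (m (a, g), a) := by
    have hc : Tendsto Prod.swap (𝓝 (e, e)) (𝓝 (e, e)) := continuous_swap.tendsto (e, e)
    have := hc.eventually h.eventually_flexible
    rw [nhds_prod_eq] at this
    exact this.curry
  filter_upwards [hflex, h.eventually_contDiffAt_left, h.eventually_contDiffAt_right,
    h.eventually_contDiffAt_right.eventually_nhds,
    h.left_unit.eventually_nhds, h.right_unit.eventually_nhds] with g hg hl hr hr' ul ur x
  have ug : m (e, g) = g := ul.self_of_nhds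
  have ug' : m (g, e) = g := ur.self_of_nhds
  let c : ℝ → E := fun t => e + t • x
  have c0 : c 0 = e := by simp [c]
  have hc : ContDiff ℝ ω c := by fun_prop
  have hcd : HasDerivAt c x 0 := by
    simpa [c] using ((hasDerivAt_id (0 : ℝ)).smul_const x).const_add e
  have hce : Tendsto c (𝓝 0) (𝓝 e) := by simpa only [c0] using hc.continuous.tendsto 0
  have hmr : ContDiffAt ℝ ω (fun t => m (g, c t)) 0 :=
    ContDiffAt.comp (g := m) (f := fun t => (g, c t)) 0 (by rwa [c0])
      (contDiffAt_const.prodMk hc.contDiffAt)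
  have hml : ContDiffAt ℝ ω (fun t => m (c t, g)) 0 :=
    ContDiffAt.comp (g := m) (f := fun t => (c t, g)) 0 (by rwa [c0])
      (hc.contDiffAt.prodMk contDiffAt_const)
  have hmrg : Tendsto (fun t => m (g, c t)) (𝓝 0) (𝓝 g) := by
    simpa only [c0, ug'] using hmr.continuousAt.tendsto
  have hmlg : Tendsto (fun t => m (c t, g)) (𝓝 0) (𝓝 g) := by
    simpa only [c0, ug] using hml.continuousAt.tendsto
  let φ : ℝ × ℝ → E := fun p => m (c p.1, m (g, c p.2)) - m (m (c p.1, g), c p.2)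
  have hφ : ContDiffAt ℝ ω φ 0 := by
    refine ContDiffAt.sub ?_ ?_
    · refine ContDiffAt.comp (g := m) (f := fun p : ℝ × ℝ => (c p.1, m (g, c p.2))) 0
        (by simpa only [Prod.fst_zero, Prod.snd_zero, c0, ug'] using hl) ?_
      exact (hc.comp contDiff_fst).contDiffAt.prodMk
        (ContDiffAt.comp (f := Prod.snd) (0 : ℝ × ℝ) hmr contDiffAt_snd)
    · refine ContDiffAt.comp (g := m) (f := fun p : ℝ × ℝ => (m (c p.1, g), c p.2)) 0
        (by simpa only [Prod.fst_zero, Prod.snd_zero, c0, ug] using hr) ?_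
      exact (ContDiffAt.comp (f := Prod.fst) (0 : ℝ × ℝ) hml contDiffAt_fst).prodMk
        (hc.comp contDiff_snd).contDiffAt
  have hzero := fderiv_fderiv_eq_zero_of_axes_diagonal hφ
    (by filter_upwards [hmlg.eventually ur] with s hs
        simp only [φ, c0, ug', hs, sub_self])
    (by filter_upwards [hmrg.eventually ul] with t ht
        simp only [φ, c0, ug, ht, sub_self])
    (by filter_upwards [hce.eventually hg] with t ht
        simp only [φ, ht, sub_self])
  have hdl : HasDerivAt (fun s => m (c s, g)) (leftField m e x g) 0 :=
    HasFDerivAt.comp_hasDerivAt (f := fun s => (c s, g)) 0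
      (by rw [c0]; exact (hl.differentiableAt (by simp)).hasFDerivAt)
      (hcd.prodMk (hasDerivAt_const (0 : ℝ) g))
  have hdr : ∀ {k : E}, ContDiffAt ℝ ω m (k, e) →
      HasDerivAt (fun t => m (k, c t)) (rightField m e x k) 0 := fun {k} hk =>
    HasFDerivAt.comp_hasDerivAt (f := fun t => (k, c t)) 0
      (by rw [c0]; exact (hk.differentiableAt (by simp)).hasFDerivAt)
      ((hasDerivAt_const (0 : ℝ) k).prodMk hcd)
  have hcg : Tendsto (fun s => (c s, g)) (𝓝 0) (𝓝 (e, g)) := hce.prodMk_nhds tendsto_const_nhds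
  have hψ : ∀ᶠ s : ℝ in 𝓝 0, HasDerivAt (fun t => φ (s, t))
      (fderiv ℝ m (c s, g) (0, rightField m e x g) - rightField m e x (m (c s, g))) 0 := by
    filter_upwards [hcg.eventually (hl.eventually (by simp)), hmlg.eventually hr'] with s h₁ h₂
    refine HasDerivAt.sub ?_ (hdr h₂)
    exact HasFDerivAt.comp_hasDerivAt (f := fun t => (c s, m (g, c t))) 0
      (by rw [c0, ug']; exact (h₁.differentiableAt (by simp)).hasFDerivAt)
      ((hasDerivAt_const (0 : ℝ) (c s)).prodMk (hdr hr))
  have hD : HasFDerivAt (fderiv ℝ m) (fderiv ℝ (fderiv ℝ m) (e, g)) (c 0, g) := by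
    rw [c0]; exact ((hl.fderiv_right (m := ω) le_rfl).differentiableAt (by simp)).hasFDerivAt
  have hD' : HasDerivAt (fun s => fderiv ℝ m (c s, g)) (fderiv ℝ (fderiv ℝ m) (e, g) (x, 0)) 0 :=
    HasFDerivAt.comp_hasDerivAt (f := fun s => (c s, g)) 0 hD
      (hcd.prodMk (hasDerivAt_const (0 : ℝ) g))
  have hfirst : HasDerivAt (fun s => fderiv ℝ m (c s, g) (0, rightField m e x g))
      (fderiv ℝ (leftField m e x) g (rightField m e x g)) 0 := by
    -- Symmetry of the second derivative turns the s-derivative of the translation by c(s) into the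
    -- g-derivative of L_x.
    rw [fderiv_leftField hl, hl.isSymmSndFDerivAt_of_omega (0, rightField m e x g) (x, 0)]
    simpa using hD'.clm_apply (hasDerivAt_const (0 : ℝ) ((0 : E), rightField m e x g))
  have hsecond : HasDerivAt (fun s => rightField m e x (m (c s, g)))
      (fderiv ℝ (rightField m e x) g (leftField m e x g)) 0 :=
    HasFDerivAt.comp_hasDerivAt (l := rightField m e x) (f := fun s => m (c s, g)) 0
      (by rw [c0, ug]; exact (hasFDerivAt_rightField hr x).differentiableAt.hasFDerivAt) hdl
  rw [fderiv_fderiv_mixed hφ hψ (hfirst.sub hsecond)] at hzero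
  rw [lieBracket, ← neg_sub, hzero, neg_zero]

theorem isInfinitesimallyMoufang (h : IsLocalMoufang m e) : IsInfinitesimallyMoufang m e where
  toIsLocalUnital := h.toIsLocalUnital
  autotopism := h.eventually_autotopism
  lieBracket_left_right_self := h.eventually_lieBracket_left_right_self

end IsLocalMoufang
end

/-! ### Transfer to the chart and conclusion -/

namespace LocalAnalyticMoufangLoop

variable {E : Type*} [NormedAddCommGroup E] [NormedSpace ℝ E] [FiniteDimensional ℝ E]
  {G : Type*} [TopologicalSpace G] [ChartedSpace E G] [IsManifold 𝓘(ℝ, E) ω G]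

/-- Near the unit all intermediate products stay in the chart domain, so the chart and its inverse
cancel between successive multiplications. -/
theorem isLocalMoufang_chartMul (M : LocalAnalyticMoufangLoop E G) :
    IsLocalMoufang (fun p : E × E => M.chartMul p.1 p.2) (extChartAt 𝓘(ℝ, E) M.one M.one) := by
  set φ := extChartAt 𝓘(ℝ, E) M.one with hφ
  set e := φ M.one with he
  have hsymm : φ.symm e = M.one := extChartAt_to_inv M.one
  have hone : M.mul M.one M.one = M.one := M.one_mul.self_of_nhds
  have hψ : ContMDiffAt 𝓘(ℝ, E) 𝓘(ℝ, E) ω φ.symm e :=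
    (contMDiffOn_extChartAt_symm M.one).contMDiffAt (extChartAt_target_mem_nhds M.one)
  have hψt : Tendsto φ.symm (𝓝 e) (𝓝 M.one) := by
    simpa only [hsymm] using hψ.continuousAt.tendsto
  have hright : ∀ᶠ u in 𝓝 e, φ (φ.symm u) = u := by
    filter_upwards [extChartAt_target_mem_nhds (I := 𝓘(ℝ, E)) M.one] with u hu
    exact φ.right_inv hu
  have hleft : ∀ᶠ g in 𝓝 M.one, φ.symm (φ g) = g := by
    filter_upwards [extChartAt_source_mem_nhds (I := 𝓘(ℝ, E)) M.one] with g hg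
    exact φ.left_inv hg
  have hmul : Tendsto (fun p : G × G => M.mul p.1 p.2) (𝓝 (M.one, M.one)) (𝓝 M.one) := by
    simpa only [hone] using M.analytic_mul.continuousAt.tendsto
  have hpair : ∀ {q q' : E × E × E → G}, Tendsto q (𝓝 (e, e, e)) (𝓝 M.one) →
      Tendsto q' (𝓝 (e, e, e)) (𝓝 M.one) →
      Tendsto (fun p => M.mul (q p) (q' p)) (𝓝 (e, e, e)) (𝓝 M.one) := fun h h' =>
    hmul.comp (h.prodMk_nhds h')
  refine ⟨⟨?_, ?_, ?_⟩, ?_⟩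
  · have h₁ : ContMDiffAt 𝓘(ℝ, E × E) 𝓘(ℝ, E) ω (fun p : E × E => φ.symm p.1) (e, e) :=
      ContMDiffAt.comp (f := Prod.fst) (e, e) hψ contDiff_fst.contMDiff.contMDiffAt
    have h₂ : ContMDiffAt 𝓘(ℝ, E × E) 𝓘(ℝ, E) ω (fun p : E × E => φ.symm p.2) (e, e) :=
      ContMDiffAt.comp (f := Prod.snd) (e, e) hψ contDiff_snd.contMDiff.contMDiffAt
    have h₃ : ContMDiffAt 𝓘(ℝ, E × E) 𝓘(ℝ, E) ω
        (fun p : E × E => M.mul (φ.symm p.1) (φ.symm p.2)) (e, e) :=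
      ContMDiffAt.comp (g := fun q : G × G => M.mul q.1 q.2)
        (f := fun p : E × E => (φ.symm p.1, φ.symm p.2)) (e, e)
        (by simpa only [hsymm] using M.analytic_mul) (h₁.prodMk h₂)
    exact (ContMDiffAt.comp (g := φ) (e, e)
      (by simpa only [hsymm, hone] using contMDiffAt_extChartAt) h₃).contDiffAt
  · filter_upwards [hψt.eventually M.one_mul, hright] with u hu hu'
    simp only [chartMul, ← hφ, hsymm, hu, hu']
  · filter_upwards [hψt.eventually M.mul_one, hright] with u hu hu'
    simp only [chartMul, ← hφ, hsymm, hu, hu']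
  · have ta : Tendsto (fun p : E × E × E => φ.symm p.1) (𝓝 (e, e, e)) (𝓝 M.one) :=
      hψt.comp continuousAt_fst
    have tg : Tendsto (fun p : E × E × E => φ.symm p.2.1) (𝓝 (e, e, e)) (𝓝 M.one) :=
      hψt.comp (continuous_snd.fst.tendsto (e, e, e))
    have th : Tendsto (fun p : E × E × E => φ.symm p.2.2) (𝓝 (e, e, e)) (𝓝 M.one) :=
      hψt.comp (continuous_snd.snd.tendsto (e, e, e))
    filter_upwards [(ta.prodMk_nhds (tg.prodMk_nhds th)).eventually M.moufang,
      (hpair ta tg).eventually hleft, (hpair th ta).eventually hleft,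
      (hpair tg th).eventually hleft, (hpair ta (hpair tg th)).eventually hleft]
      with p hp h₁ h₂ h₃ h₄
    simp only [chartMul, ← hφ, h₁, h₂, h₃, h₄, hp]

/-- The iterated partial derivative is the total second derivative on (x, 0) and (0, y), since the
partial derivative in v at (u, e) is the total one composed with the second inclusion. -/
theorem mixed_apply (M : LocalAnalyticMoufangLoop E G) (x y : E) :
    M.mixed x y = mixedSecond (fun p : E × E => M.chartMul p.1 p.2)
      (extChartAt 𝓘(ℝ, E) M.one M.one) x y := by
  set e := extChartAt 𝓘(ℝ, E) M.one M.one with he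
  set m : E × E → E := fun p => M.chartMul p.1 p.2 with hm
  have h : IsLocalUnital m e := M.isLocalMoufang_chartMul.toIsLocalUnital
  have hfirst : (fun u => fderiv ℝ (fun v => M.chartMul u v) e) =ᶠ[𝓝 e]
      fun u => (fderiv ℝ m (u, e)).comp (.inr ℝ E E) := by
    filter_upwards [h.eventually_contDiffAt_right] with u hu
    exact (HasFDerivAt.comp (g := m) (f := fun v : E => (u, v)) e
      (hu.differentiableAt (by simp)).hasFDerivAt (hasFDerivAt_prodMk_right u e)).fderiv
  have hD : HasFDerivAt (fun u => fderiv ℝ m (u, e))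
      ((fderiv ℝ (fderiv ℝ m) (e, e)).comp (.inl ℝ E E)) e :=
    HasFDerivAt.comp (g := fderiv ℝ m) (f := fun u : E => (u, e)) e
      ((h.contDiffAt.fderiv_right (m := ω) le_rfl).differentiableAt (by simp)).hasFDerivAt
      (hasFDerivAt_prodMk_left e e)
  have hmixed : HasFDerivAt (fun u => fderiv ℝ (fun v => M.chartMul u v) e) _ e :=
    (hD.clm_comp (hasFDerivAt_const (ContinuousLinearMap.inr ℝ E E) e)).congr_of_eventuallyEq hfirst
  rw [mixed, hmixed.fderiv]
  simp [mixedSecond]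

end LocalAnalyticMoufangLoop

theorem mainTheorem4 {E : Type*} [NormedAddCommGroup E] [NormedSpace ℝ E]
    [FiniteDimensional ℝ E] {G : Type*} [TopologicalSpace G] [ChartedSpace E G]
    [IsManifold 𝓘(ℝ, E) ω G] (M : LocalAnalyticMoufangLoop E G) (x y z w : M.Tangent) :
    M.yamagutian x y (M.bracket z w) =
      M.bracket (M.yamagutian x y z) w + M.bracket z (M.yamagutian x y w) := by
  have : CompleteSpace E := FiniteDimensional.complete ℝ E
  let b : E →ₗ[ℝ] E →ₗ[ℝ] E := M.bracket
  have hb : ∀ u v : E, b u v = M.mixed u v - M.mixed v u := fun _ _ => rfl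
  suffices h : ∀ x y z w : E,
      (1 / 6 : ℝ) • (b x (b y (b z w)) - b y (b x (b z w)) + b (b x y) (b z w)) =
        b ((1 / 6 : ℝ) • (b x (b y z) - b y (b x z) + b (b x y) z)) w +
          b z ((1 / 6 : ℝ) • (b x (b y w) - b y (b x w) + b (b x y) w)) from h x y z w
  intro x y z w
  rw [yamaguti_derivation_of_ad_derivation b (fun u v => by rw [hb, hb, neg_sub])
    (M.isLocalMoufang_chartMul.isInfinitesimallyMoufang.ad_derivation b
      (fun u v => by rw [hb, M.mixed_apply, M.mixed_apply])) x y z w,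
    map_smul, map_smul, LinearMap.smul_apply, smul_add]
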